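/- Let $d\ge 1$, let $\Omega\subset\mathbb R^d$ be a smooth bounded open set, let $q\ge 1$, $\lambda>0$ and $\delta>0$ be real numbers, and let $f\in L^q(\Omega)$ (all functions are real-valued). Let $\varphi:[0,\infty)\to[0,\infty)$ satisfy $\varphi(0)=0$, be continuous on $[0,\infty)$ except at a finite number of points of $(0,\infty)$ where it has limits from the left and from the right, and satisfy $\varphi(t)=\min\{\varphi(t+),\varphi(t-)\}$ for all $t>0$. Assume that $\varphi\in\mathcal A$, that is: 1. there is a constant $a>0$ with $\varphi(t)\le a t^2$ for all $t\in[0,1]$; 2. there is a constant $b>0$ with $\varphi(t)\le b$ for all $t\ge 0$; 3. $\varphi$ is non-decreasing; 4. $\gamma_d\int_0^\infty \varphi(t)\,t^{-2}\,dt=1$, where $\gamma_d=\int_{\mathbb S^{d-1}}|\sigma\cdot e|\,d\sigma$ for a unit vector $e\in\mathbb S^{d-1}$ (the value does not depend on $e$). Assume moreover that $\varphi(t)>0$ for all $t>0$. For $u\in L^q(\Omega)$ put $$ E_\delta(u)=\lambda\int_\Omega|u-f|^q\,dx+\Lambda_\delta(u),\qquad \Lambda_\delta(u)=\delta\int_\Omega\int_\Omega\frac{\varphi\big(|u(x)-u(y)|/\delta\big)}{|x-y|^{d+1}}\,dx\,dy\in[0,\infty].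 $$ Then $E_\delta$ attains its minimum on $L^q(\Omega)$: there exists $u\in L^q(\Omega)$ such that $$ E_\delta(u)=\inf_{w\in L^q(\Omega)}E_\delta(w). $$ -/

import Mathlib

open MeasureTheory Set Filter Topology
open scoped ENNReal ContDiff

namespace NonlocalTV

/-- The Euclidean space `ℝ^d`. -/
abbrev Space (d : ℕ) : Type := EuclideanSpace ℝ (Fin d)

/-- A smooth bounded open subset of `ℝ^d`: near each boundary point, `Ω` is the sublevel set
`{ρ < 0}` of a `C^∞` function `ρ` whose differential does not vanish at that point (so that `Ω`
lies locally on one side of a smooth hypersurface). -/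
structure IsSmoothBoundedOpen {d : ℕ} (Ω : Set (Space d)) : Prop where
  isOpen : IsOpen Ω
  isBounded : Bornology.IsBounded Ω
  smooth_boundary : ∀ x₀ ∈ frontier Ω, ∃ (U : Set (Space d)) (ρ : Space d → ℝ),
    IsOpen U ∧ x₀ ∈ U ∧ ContDiffOn ℝ ∞ ρ U ∧ fderiv ℝ ρ x₀ ≠ 0 ∧
      Ω ∩ U = {x ∈ U | ρ x < 0}

/-- The integral `∫_{𝕊^{d-1}} |σ · e| dσ` with respect to the surface measure of the unit sphere.
Its value is the same for all unit vectors `e`; it is called `γ_d`. -/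
noncomputable def sphereIntegral {d : ℕ} (e : Space d) : ℝ :=
  ∫ σ : Metric.sphere (0 : Space d) 1, |inner ℝ (σ : Space d) e|
    ∂((volume : Measure (Space d)).toSphere)

/-- The class `𝒜` of functions `φ : [0, ∞) → [0, ∞)` in dimension `d`. A function on `[0, ∞)` is
represented by a function on `ℝ`, of which only the values on `[0, ∞)` are constrained or used. -/
structure ClassA (d : ℕ) (φ : ℝ → ℝ) : Prop where
  nonneg : ∀ t, 0 ≤ t → 0 ≤ φ t
  map_zero : φ 0 = 0
  /-- Continuity on `[0, ∞)` except at a finite number of points of `(0, ∞)`. -/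
  continuous_off_finite : ∃ S : Set ℝ, S.Finite ∧ S ⊆ Ioi 0 ∧
    ∀ t ∈ Ici (0 : ℝ) \ S, ContinuousWithinAt φ (Ici 0) t
  /-- The one-sided limits exist, and `φ(t) = min {φ(t+), φ(t-)}`. -/
  eq_min_limits : ∀ t, 0 < t → ∃ l r : ℝ,
    Tendsto φ (𝓝[<] t) (𝓝 l) ∧ Tendsto φ (𝓝[>] t) (𝓝 r) ∧ φ t = min r l
  le_sq : ∃ a : ℝ, 0 < a ∧ ∀ t ∈ Icc (0 : ℝ) 1, φ t ≤ a * t ^ 2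
  le_const : ∃ b : ℝ, 0 < b ∧ ∀ t, 0 ≤ t → φ t ≤ b
  monotone : MonotoneOn φ (Ici 0)
  normalized : ∃ e : Space d, ‖e‖ = 1 ∧
    sphereIntegral e * ∫ t in Ioi (0 : ℝ), φ t / t ^ 2 = 1

/-- `Λ(u) = ∫_Ω ∫_Ω φ(|u(x) - u(y)|) / |x - y|^{d+1} dx dy`, with values in `[0, ∞]`. -/
noncomputable def Lambda {d : ℕ} (φ : ℝ → ℝ) (Ω : Set (Space d)) (u : Space d → ℝ) : ℝ≥0∞ :=
  ∫⁻ y in Ω, ∫⁻ x in Ω, ENNReal.ofReal (φ |u x - u y| / ‖x - y‖ ^ (d + 1))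

/-- `Λ_δ(u) = δ Λ(u / δ)`. -/
noncomputable def LambdaDelta {d : ℕ} (φ : ℝ → ℝ) (Ω : Set (Space d)) (δ : ℝ)
    (u : Space d → ℝ) : ℝ≥0∞ :=
  ENNReal.ofReal δ * Lambda φ Ω (fun x => u x / δ)

/-- The space `L^q(Ω)` of real-valued functions, for a real exponent `q`. -/
abbrev LqSpace {d : ℕ} (q : ℝ) (Ω : Set (Space d)) : Type :=
  Lp ℝ (ENNReal.ofReal q) ((volume : Measure (Space d)).restrict Ω)

/-- `E_δ(u) = lam ∫_Ω |u - f|^q + Λ_δ(u)`, with values in `[0, ∞]`. -/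
noncomputable def energy {d : ℕ} (φ : ℝ → ℝ) (Ω : Set (Space d)) (q lam δ : ℝ)
    (f u : LqSpace q Ω) : ℝ≥0∞ :=
  ENNReal.ofReal lam * (∫⁻ x in Ω, ENNReal.ofReal (|u x - f x| ^ q)) + LambdaDelta φ Ω δ u

end NonlocalTV

namespace NonlocalTV

/-! The proof is the direct method, run with almost everywhere convergence. Lower semicontinuity
(`ClassA.energy_le_liminf`) is Fatou's lemma: a non-decreasing `φ` that equals the smaller of its
one-sided limits is lower semicontinuous. Compactness
(`ClassA.exists_subseq_ae_tendsto_of_energy_le`) is the main point. Since `φ` is bounded, `Λ` does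
not see the size of large jumps, so it is applied to the truncation `arctan ∘ v`. In a ball of
radius `r`, a pair with `|v x - v y| > η` costs at least `φ η / (2r)^(d+1)`. Hence the total mean
oscillation over disjoint balls of radius below `ρ` is at most `η |Ω|` plus a multiple of `ρ Λ(v) /
φ η`, which is small uniformly along the sequence. Once the averages over these finitely many balls
converge, `arctan ∘ v` is Cauchy in `L¹`. The fidelity term then keeps the limit of `arctan` away
from `±π/2` almost everywhere, which undoes the truncation. -/

/-! ### Lower semicontinuity of `Λ`. -/

lemma measurable_comp_abs_of_monotoneOn {φ : ℝ → ℝ} (hφ : MonotoneOn φ (Ici 0)) :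
    Measurable fun t : ℝ => φ |t| := by
  have h : Monotone fun t : ℝ => φ (max t 0) := fun s t hst =>
    hφ (mem_Ici.2 (le_max_right _ _)) (mem_Ici.2 (le_max_right _ _)) (max_le_max_right 0 hst)
  have h' : (fun t : ℝ => φ |t|) = (fun t : ℝ => φ (max t 0)) ∘ fun t => |t| := by
    funext t
    simp
  rw [h']
  exact h.measurable.comp measurable_id.abs

/-- Monotonicity gives `φ(t-) ≤ φ t`, and the minimum convention gives the reverse inequality. -/
lemma ClassA.tendsto_left {d : ℕ} {φ : ℝ → ℝ} (hφ : ClassA d φ) {t : ℝ} (ht : 0 < t) :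
    Tendsto φ (𝓝[<] t) (𝓝 (φ t)) := by
  obtain ⟨l, r, hl, -, hlr⟩ := hφ.eq_min_limits t ht
  have hle : l ≤ φ t := by
    refine le_of_tendsto hl ?_
    filter_upwards [Ioo_mem_nhdsLT ht] with s hs
    exact hφ.monotone hs.1.le ht.le hs.2.le
  have : φ t = l := le_antisymm (hlr ▸ min_le_right r l) hle
  rwa [this]

lemma ClassA.lowerSemicontinuous_comp_abs {d : ℕ} {φ : ℝ → ℝ} (hφ : ClassA d φ) :
    LowerSemicontinuous fun t : ℝ => φ |t| := by
  intro t c hc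
  change c < φ |t| at hc
  rcases (abs_nonneg t).eq_or_lt with h0 | hpos
  · rw [← h0, hφ.map_zero] at hc
    exact Eventually.of_forall fun s => hc.trans_le (hφ.nonneg _ (abs_nonneg s))
  · obtain ⟨s, hcs, hs0, hst⟩ := (((hφ.tendsto_left hpos).eventually (lt_mem_nhds hc)).and
      (Ioo_mem_nhdsLT hpos)).exists
    filter_upwards [(continuous_abs.tendsto t).eventually (lt_mem_nhds hst)] with x hx
    exact hcs.trans_le (hφ.monotone hs0.le (abs_nonneg x) hx.le)

/-- The integrand of `Lambda`. -/
noncomputable def interaction {d : ℕ} (φ : ℝ → ℝ) (u : Space d → ℝ) (x y : Space d) : ℝ≥0∞ :=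
  ENNReal.ofReal (φ |u x - u y| / ‖x - y‖ ^ (d + 1))

lemma Lambda_eq {d : ℕ} (φ : ℝ → ℝ) (Ω : Set (Space d)) (u : Space d → ℝ) :
    Lambda φ Ω u = ∫⁻ y in Ω, ∫⁻ x in Ω, interaction φ u x y := rfl

lemma measurable_interaction {d : ℕ} {φ : ℝ → ℝ} (hφ : MonotoneOn φ (Ici 0))
    {u : Space d → ℝ} (hu : Measurable u) :
    Measurable fun p : Space d × Space d => interaction φ u p.1 p.2 := by
  refine ENNReal.measurable_ofReal.comp (Measurable.div ?_ ?_)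
  · exact (measurable_comp_abs_of_monotoneOn hφ).comp
      ((hu.comp measurable_fst).sub (hu.comp measurable_snd))
  · exact (measurable_fst.sub measurable_snd).norm.pow_const _

lemma ClassA.interaction_le_liminf {d : ℕ} {φ : ℝ → ℝ} (hφ : ClassA d φ)
    {v : ℕ → Space d → ℝ} {u : Space d → ℝ} {x y : Space d}
    (hx : Tendsto (fun n => v n x) atTop (𝓝 (u x)))
    (hy : Tendsto (fun n => v n y) atTop (𝓝 (u y))) :
    interaction φ u x y ≤ liminf (fun n => interaction φ (v n) x y) atTop := by
  have hg : LowerSemicontinuous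
      fun t : ℝ => ENNReal.ofReal (φ |t| / ‖x - y‖ ^ (d + 1)) := by
    refine Continuous.comp_lowerSemicontinuous
      (g := fun s : ℝ => ENNReal.ofReal (s / ‖x - y‖ ^ (d + 1)))
      (ENNReal.continuous_ofReal.comp (continuous_id.div_const _))
      hφ.lowerSemicontinuous_comp_abs ?_
    intro s t hst
    exact ENNReal.ofReal_le_ofReal (by gcongr)
  exact (hg.le_liminf _).trans ((hx.sub hy).liminf_le_liminf_comp)

lemma ClassA.Lambda_le_liminf {d : ℕ} {φ : ℝ → ℝ} (hφ : ClassA d φ) {Ω : Set (Space d)}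
    {v : ℕ → Space d → ℝ} {u : Space d → ℝ} (hv : ∀ n, Measurable (v n))
    (h : ∀ᵐ x ∂volume.restrict Ω, Tendsto (fun n => v n x) atTop (𝓝 (u x))) :
    Lambda φ Ω u ≤ liminf (fun n => Lambda φ Ω (v n)) atTop := by
  have hm : ∀ n, Measurable fun p : Space d × Space d => interaction φ (v n) p.1 p.2 :=
    fun n => measurable_interaction hφ.monotone (hv n)
  calc Lambda φ Ω u
      ≤ ∫⁻ y in Ω, liminf (fun n => ∫⁻ x in Ω, interaction φ (v n) x y) atTop := by
        rw [Lambda_eq]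
        refine lintegral_mono_ae ?_
        filter_upwards [h] with y hy
        calc ∫⁻ x in Ω, interaction φ u x y
            ≤ ∫⁻ x in Ω, liminf (fun n => interaction φ (v n) x y) atTop := by
              refine lintegral_mono_ae ?_
              filter_upwards [h] with x hx
              exact hφ.interaction_le_liminf hx hy
          _ ≤ _ := lintegral_liminf_le fun n => (hm n).comp measurable_prodMk_right
    _ ≤ _ := lintegral_liminf_le fun n => (hm n).lintegral_prod_left

/-! ### Truncation by `arctan`. -/

/-- Smooth truncation by `arctan` does not lose convergence of a sequence that has a bounded
subsequence. -/
lemma exists_tendsto_of_tendsto_arctan {a : ℕ → ℝ} {l : ℝ} {K : ℝ}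
    (ha : Tendsto (fun n => Real.arctan (a n)) atTop (𝓝 l))
    (hK : ∃ᶠ n in atTop, |a n| ≤ K) : ∃ b, Tendsto a atTop (𝓝 b) := by
  have h1 : l ≤ Real.arctan K := le_of_tendsto_of_frequently ha
    (hK.mono fun n hn => Real.arctan_strictMono.monotone (abs_le.1 hn).2)
  have h2 : Real.arctan (-K) ≤ l := ge_of_tendsto_of_frequently ha
    (hK.mono fun n hn => Real.arctan_strictMono.monotone (abs_le.1 hn).1)
  -- The bounds on `l` keep it strictly inside `(-π/2, π/2)`, where `tan` is continuous.
  have hcos : Real.cos l ≠ 0 := (Real.cos_pos_of_mem_Ioo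
    ⟨(Real.neg_pi_div_two_lt_arctan _).trans_le h2,
      h1.trans_lt (Real.arctan_lt_pi_div_two _)⟩).ne'
  refine ⟨Real.tan l, ?_⟩
  simpa [Function.comp_def, Real.tan_arctan] using
    (Real.continuousAt_tan.2 hcos).tendsto.comp ha

lemma abs_arctan_sub_arctan_le (s t : ℝ) : |Real.arctan s - Real.arctan t| ≤ |s - t| := by
  have h : LipschitzWith 1 Real.arctan := by
    refine lipschitzWith_of_nnnorm_deriv_le Real.differentiable_arctan fun x => ?_
    rw [← NNReal.coe_le_coe, coe_nnnorm, Real.deriv_arctan, Real.norm_of_nonneg (by positivity)]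
    exact div_le_one_of_le₀ (by nlinarith [sq_nonneg x]) (by positivity)
  simpa [Real.dist_eq] using h.dist_le_mul s t

lemma abs_arctan_le (s : ℝ) : |Real.arctan s| ≤ Real.pi / 2 :=
  abs_le.2 ⟨(Real.neg_pi_div_two_lt_arctan s).le, (Real.arctan_lt_pi_div_two s).le⟩

/-! ### Coverings by small balls and mean oscillation. -/

/-- An open set of finite measure can be covered, up to a set of small measure, by finitely many
disjoint small closed balls. -/
lemma exists_finset_closedBall_covering {d : ℕ} {Ω : Set (Space d)} (hΩ : IsOpen Ω)
    (hfin : volume Ω ≠ ⊤) {ρ : ℝ} (hρ : 0 < ρ) {ε : ℝ≥0∞} (hε : ε ≠ 0) :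
    ∃ (F : Finset (Space d)) (r : Space d → ℝ),
      (∀ c ∈ F, 0 < r c ∧ r c < ρ ∧ Metric.closedBall c (r c) ⊆ Ω) ∧
      (F : Set (Space d)).PairwiseDisjoint (fun c => Metric.closedBall c (r c)) ∧
      volume (Ω \ ⋃ c ∈ F, Metric.closedBall c (r c)) ≤ ε := by
  obtain ⟨t, r, htc, -, hr, hcov, hdisj⟩ := Besicovitch.exists_disjoint_closedBall_covering_ae
    (volume : Measure (Space d)) (fun x => {s | Metric.closedBall x s ⊆ Ω}) Ω (by
      intro x hx δ hδ
      obtain ⟨s, hs, hsΩ⟩ := Metric.nhds_basis_closedBall.mem_iff.1 (hΩ.mem_nhds hx)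
      exact ⟨min s (δ / 2), (Metric.closedBall_subset_closedBall (min_le_left _ _)).trans hsΩ,
        lt_min hs (half_pos hδ), (min_le_right _ _).trans_lt (half_lt_self hδ)⟩)
    (fun _ => ρ) (fun _ _ => hρ)
  have : Countable t := htc.to_subtype
  -- The Besicovitch family is countable and covers `Ω` almost everywhere; continuity from above
  -- along its finite subfamilies yields a finite one.
  let s : Finset t → Set (Space d) := fun F => Ω \ ⋃ c ∈ F, Metric.closedBall (c : Space d) (r c)
  have hanti : Antitone s := fun F G hFG => sdiff_subset_sdiff_right
    (biUnion_subset_biUnion_left fun c hc => hFG hc)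
  have hlim : Tendsto (volume ∘ s) atTop (𝓝 (volume (⋂ F, s F))) :=
    tendsto_measure_iInter_atTop (fun F => (hΩ.measurableSet.diff
      (F.measurableSet_biUnion fun c _ => Metric.isClosed_closedBall.measurableSet)).nullMeasurableSet)
      hanti ⟨∅, ((measure_mono sdiff_subset).trans_lt hfin.lt_top).ne⟩
  have hnull : volume (⋂ F, s F) = 0 := by
    refine measure_mono_null (fun x hx => ?_) hcov
    rw [mem_iInter] at hx
    refine ⟨(hx ∅).1, fun hmem => ?_⟩
    obtain ⟨c, hc, hxc⟩ := mem_iUnion₂.1 hmem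
    exact (hx {⟨c, hc⟩}).2 (by simpa using hxc)
  rw [hnull] at hlim
  obtain ⟨F, hF⟩ := (hlim.eventually (ge_mem_nhds (pos_iff_ne_zero.2 hε))).exists
  refine ⟨F.map (Function.Embedding.subtype _), r, ?_, ?_, ?_⟩
  · intro c hc
    obtain ⟨⟨c, hct⟩, -, rfl⟩ := Finset.mem_map.1 hc
    exact ⟨(hr c hct).2.1, (hr c hct).2.2, (hr c hct).1⟩
  · refine hdisj.subset fun c hc => ?_
    obtain ⟨⟨c, hct⟩, -, rfl⟩ := Finset.mem_map.1 hc
    exact hct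
  · refine (measure_mono (sdiff_subset_sdiff_right ?_)).trans hF
    intro x hx
    obtain ⟨c, hc, hxc⟩ := mem_iUnion₂.1 hx
    exact mem_iUnion₂.2 ⟨c, Finset.mem_map_of_mem _ hc, hxc⟩

lemma lintegral_enorm_sub_setAverage_le {X : Type*} [MeasurableSpace X] {μ : Measure X}
    {B : Set X} (h0 : μ B ≠ 0) (hfin : μ B ≠ ⊤) {w : X → ℝ} (hw : IntegrableOn w B μ) :
    ∫⁻ y in B, ‖w y - ⨍ x in B, w x ∂μ‖ₑ ∂μ ≤
      (μ B)⁻¹ * ∫⁻ y in B, ∫⁻ x in B, ‖w x - w y‖ₑ ∂μ ∂μ := by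
  rw [← lintegral_const_mul' _ _ (ENNReal.inv_ne_top.2 h0)]
  refine lintegral_mono fun y => ?_
  have hne : (μ.real B) ≠ 0 := (ENNReal.toReal_pos h0 hfin).ne'
  have h : w y - ⨍ x in B, w x ∂μ = (μ.real B)⁻¹ * ∫ x in B, (w y - w x) ∂μ := by
    have hc : IntegrableOn (fun _ => w y) B μ := integrableOn_const hfin
    rw [integral_sub hc hw, setAverage_eq, setIntegral_const, smul_eq_mul, smul_eq_mul]
    field_simp
  calc ‖w y - ⨍ x in B, w x ∂μ‖ₑ = (μ B)⁻¹ * ‖∫ x in B, (w y - w x) ∂μ‖ₑ := by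
        rw [h, enorm_mul, enorm_inv hne, measureReal_def, Real.enorm_eq_ofReal
          ENNReal.toReal_nonneg, ENNReal.ofReal_toReal hfin]
    _ ≤ (μ B)⁻¹ * ∫⁻ x in B, ‖w y - w x‖ₑ ∂μ := by
        gcongr
        exact enorm_integral_le_lintegral_enorm _
    _ = _ := by simp_rw [enorm_sub_rev]

/-- If `|v x - v y| ≤ η`, then `arctan` being 1-Lipschitz suffices. Otherwise the interaction is at
least `φ η / (2r)^(d+1)`, which absorbs the trivial bound `π`. -/
lemma enorm_arctan_sub_le_interaction {d : ℕ} {φ : ℝ → ℝ} (hφ : MonotoneOn φ (Ici 0))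
    {η : ℝ} (hη : 0 < η) (hφη : 0 < φ η) {v : Space d → ℝ} {x y : Space d} {r : ℝ}
    (hxy : ‖x - y‖ ≤ 2 * r) :
    ‖Real.arctan (v x) - Real.arctan (v y)‖ₑ ≤
      ENNReal.ofReal η + ENNReal.ofReal (Real.pi * (2 * r) ^ (d + 1) / φ η) *
        interaction φ v x y := by
  rw [Real.enorm_eq_ofReal_abs]
  rcases le_or_gt |v x - v y| η with h | h
  · exact le_add_right (ENNReal.ofReal_le_ofReal ((abs_arctan_sub_arctan_le _ _).trans h))
  · refine le_add_left ?_
    have hr : 0 ≤ 2 * r := (norm_nonneg _).trans hxy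
    have hne : 0 < ‖x - y‖ := by
      rw [norm_pos_iff, sub_ne_zero]
      rintro rfl
      simp only [sub_self, abs_zero] at h
      exact hη.not_gt h
    rw [interaction, ← ENNReal.ofReal_mul (by positivity)]
    refine ENNReal.ofReal_le_ofReal ?_
    have h1 : |Real.arctan (v x) - Real.arctan (v y)| ≤ Real.pi := by
      have := abs_sub (Real.arctan (v x)) (Real.arctan (v y))
      linarith [abs_arctan_le (v x), abs_arctan_le (v y)]
    have h2 : φ η ≤ φ |v x - v y| := hφ hη.le (mem_Ici.2 (abs_nonneg _)) h.le
    refine h1.trans ?_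
    rw [div_mul_div_comm, le_div_iff₀ (by positivity), mul_assoc]
    refine mul_le_mul_of_nonneg_left ?_ Real.pi_pos.le
    rw [mul_comm]
    exact mul_le_mul (pow_le_pow_left₀ hne.le hxy _) h2 hφη.le (by positivity)

lemma integrableOn_arctan_comp {X : Type*} [MeasurableSpace X] {μ : Measure X} {v : X → ℝ}
    (hv : Measurable v) {B : Set X} (hB : μ B ≠ ⊤) :
    IntegrableOn (fun x => Real.arctan (v x)) B μ :=
  Measure.integrableOn_of_bounded (M := Real.pi / 2) hB
    (Real.measurable_arctan.comp hv).aestronglyMeasurable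
    (Eventually.of_forall fun x => abs_arctan_le (v x))

/-- A Poincaré-type estimate: averaging costs `r^(-d)` while the kernel gains `r^(d+1)`, so one
factor `r ≤ ρ` is left over. -/
lemma lintegral_arctan_oscillation_closedBall_le {d : ℕ} {φ : ℝ → ℝ}
    (hφ : MonotoneOn φ (Ici 0)) {η : ℝ} (hη : 0 < η) (hφη : 0 < φ η) {v : Space d → ℝ}
    (hv : Measurable v) {c : Space d} {r ρ : ℝ} (hr : 0 < r) (hrρ : r ≤ ρ) :
    ∫⁻ y in Metric.closedBall c r,
        ‖Real.arctan (v y) - ⨍ x in Metric.closedBall c r, Real.arctan (v x)‖ₑ ≤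
      ENNReal.ofReal η * volume (Metric.closedBall c r) +
        ENNReal.ofReal (Real.pi * 2 ^ (d + 1) * ρ / φ η) *
          (volume (Metric.closedBall (0 : Space d) 1))⁻¹ *
          ∫⁻ y in Metric.closedBall c r, ∫⁻ x in Metric.closedBall c r, interaction φ v x y := by
  set B := Metric.closedBall c r
  have h0 : volume B ≠ 0 := (Metric.measure_closedBall_pos _ c hr).ne'
  have hfin : volume B ≠ ⊤ := measure_closedBall_lt_top.ne
  set A := ENNReal.ofReal (Real.pi * (2 * r) ^ (d + 1) / φ η)
  have hA : (volume B)⁻¹ * A ≤ ENNReal.ofReal (Real.pi * 2 ^ (d + 1) * ρ / φ η) *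
      (volume (Metric.closedBall (0 : Space d) 1))⁻¹ := by
    have hvol : volume B = ENNReal.ofReal (r ^ d) * volume (Metric.closedBall (0 : Space d) 1) := by
      simpa using Measure.addHaar_closedBall' (volume : Measure (Space d)) c hr.le
    have hrd : 0 < r ^ d := by positivity
    rw [hvol, ENNReal.mul_inv (Or.inl (ENNReal.ofReal_pos.2 hrd).ne')
      (Or.inl ENNReal.ofReal_ne_top), mul_right_comm, ← ENNReal.ofReal_inv_of_pos hrd,
      ← ENNReal.ofReal_mul (by positivity)]
    gcongr
    calc (r ^ d)⁻¹ * (Real.pi * (2 * r) ^ (d + 1) / φ η)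
        = Real.pi * 2 ^ (d + 1) * r / φ η := by
          field_simp
          ring
      _ ≤ _ := by gcongr
  calc _ ≤ (volume B)⁻¹ * ∫⁻ y in B, ∫⁻ x in B, ‖Real.arctan (v x) - Real.arctan (v y)‖ₑ :=
        lintegral_enorm_sub_setAverage_le h0 hfin (integrableOn_arctan_comp hv hfin)
    _ ≤ (volume B)⁻¹ * ∫⁻ y in B, ∫⁻ x in B, (ENNReal.ofReal η + A * interaction φ v x y) := by
        refine mul_le_mul_right ?_ _
        have hB : MeasurableSet B := measurableSet_closedBall
        refine setLIntegral_mono' hB fun y hy => setLIntegral_mono' hB fun x hx => ?_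
        refine enorm_arctan_sub_le_interaction hφ hη hφη ?_
        rw [← dist_eq_norm]
        have := dist_triangle_right x y c
        linarith [Metric.mem_closedBall.1 hx, Metric.mem_closedBall.1 hy]
    _ = (volume B)⁻¹ * (ENNReal.ofReal η * volume B * volume B +
          A * ∫⁻ y in B, ∫⁻ x in B, interaction φ v x y) := by
        have h1 : ∀ y, ∫⁻ x in B, (ENNReal.ofReal η + A * interaction φ v x y) =
            ENNReal.ofReal η * volume B + A * ∫⁻ x in B, interaction φ v x y := fun y => by
          rw [lintegral_add_left measurable_const, setLIntegral_const,
            lintegral_const_mul' _ _ ENNReal.ofReal_ne_top]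
        simp_rw [h1]
        rw [lintegral_add_left measurable_const, setLIntegral_const,
          lintegral_const_mul' _ _ ENNReal.ofReal_ne_top]
    _ = ENNReal.ofReal η * volume B * ((volume B)⁻¹ * volume B) +
          (volume B)⁻¹ * A * ∫⁻ y in B, ∫⁻ x in B, interaction φ v x y := by ring
    _ ≤ _ := by
        rw [ENNReal.inv_mul_cancel h0 hfin, mul_one]
        gcongr

/-- At small scales, the total mean oscillation of `arctan ∘ v` is controlled by `Λ(v)`. -/
lemma exists_covering_sum_oscillation_le {d : ℕ} {φ : ℝ → ℝ}
    (hφ : MonotoneOn φ (Ici 0)) (hpos : ∀ t, 0 < t → 0 < φ t) {Ω : Set (Space d)}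
    (hΩ : IsOpen Ω) (hfin : volume Ω ≠ ⊤) {ε : ℝ} (hε : 0 < ε) :
    ∃ F : Finset (Set (Space d)), (∀ B ∈ F, MeasurableSet B ∧ B ⊆ Ω) ∧
      volume (Ω \ ⋃ B ∈ F, B) ≤ ENNReal.ofReal ε ∧
      ∀ v : Space d → ℝ, Measurable v →
        ∑ B ∈ F, ∫⁻ y in B, ‖Real.arctan (v y) - ⨍ x in B, Real.arctan (v x)‖ₑ ≤
          ENNReal.ofReal ε * (volume Ω +
            (volume (Metric.closedBall (0 : Space d) 1))⁻¹ * Lambda φ Ω v) := by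
  classical
  have hφε := hpos ε hε
  -- With threshold `η = ε`, this radius makes the coefficient of the interaction term exactly `ε`.
  -- It does not depend on `v`, so one covering serves all functions.
  set ρ := ε * φ ε / (Real.pi * 2 ^ (d + 1)) with hρdef
  have hρ : 0 < ρ := by positivity
  have hρε : Real.pi * 2 ^ (d + 1) * ρ / φ ε = ε := by
    rw [hρdef]
    field_simp
  obtain ⟨F, r, hF, hdisj, hcov⟩ := exists_finset_closedBall_covering hΩ hfin hρ
    (ENNReal.ofReal_pos.2 hε).ne'
  -- Disjoint balls containing their centres are distinct, so the sum may be indexed by the balls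
  -- themselves.
  have hinj : InjOn (fun c => Metric.closedBall c (r c)) (F : Set (Space d)) := by
    intro c hc c' hc' h
    by_contra hne
    exact (Set.disjoint_left.1 (hdisj hc hc' hne)) (Metric.mem_closedBall_self (hF c hc).1.le)
      ((show Metric.closedBall c (r c) = _ from h) ▸ Metric.mem_closedBall_self (hF c hc).1.le)
  have hU : (⋃ c ∈ F, Metric.closedBall c (r c)) ⊆ Ω := iUnion₂_subset fun c hc => (hF c hc).2.2
  refine ⟨F.image fun c => Metric.closedBall c (r c), ?_, ?_, ?_⟩
  · intro B hB
    obtain ⟨c, hc, rfl⟩ := Finset.mem_image.1 hB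
    exact ⟨measurableSet_closedBall, (hF c hc).2.2⟩
  · simpa using hcov
  · intro v hv
    rw [Finset.sum_image hinj]
    set κ := (volume (Metric.closedBall (0 : Space d) 1))⁻¹
    calc _ ≤ ∑ c ∈ F, (ENNReal.ofReal ε * volume (Metric.closedBall c (r c)) +
          ENNReal.ofReal ε * κ * ∫⁻ y in Metric.closedBall c (r c),
            ∫⁻ x in Ω, interaction φ v x y) := by
          refine Finset.sum_le_sum fun c hc => ?_
          have h := lintegral_arctan_oscillation_closedBall_le hφ hε hφε hv (c := c)
            (hF c hc).1 (hF c hc).2.1.le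
          rw [hρε] at h
          refine h.trans ?_
          refine add_le_add_right (mul_le_mul_right ?_ _) _
          exact lintegral_mono fun y => lintegral_mono_set (hF c hc).2.2
      _ = ENNReal.ofReal ε * volume (⋃ c ∈ F, Metric.closedBall c (r c)) +
          ENNReal.ofReal ε * κ * ∫⁻ y in ⋃ c ∈ F, Metric.closedBall c (r c),
            ∫⁻ x in Ω, interaction φ v x y := by
          rw [Finset.sum_add_distrib, ← Finset.mul_sum, ← Finset.mul_sum,
            measure_biUnion_finset hdisj fun _ _ => measurableSet_closedBall,
            lintegral_biUnion_finset hdisj fun _ _ => measurableSet_closedBall]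
      _ ≤ ENNReal.ofReal ε * volume Ω + ENNReal.ofReal ε * κ * Lambda φ Ω v := by
          rw [Lambda_eq]
          gcongr
      _ = _ := by ring

/-! ### Almost everywhere compactness from small oscillation. -/

lemma lintegral_enorm_sub_le_of_oscillation {X : Type*} [MeasurableSpace X] {μ : Measure X}
    {B : Set X} {w w' : X → ℝ} (hw : Measurable w) (hw' : Measurable w') (a a' : ℝ) :
    ∫⁻ x in B, ‖w x - w' x‖ₑ ∂μ ≤
      ∫⁻ x in B, ‖w x - a‖ₑ ∂μ + ∫⁻ x in B, ‖w' x - a'‖ₑ ∂μ + ‖a - a'‖ₑ * μ B := by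
  rw [← setLIntegral_const, ← lintegral_add_left (by fun_prop), ← lintegral_add_left (by fun_prop)]
  refine lintegral_mono fun x => ?_
  calc ‖w x - w' x‖ₑ = ‖(w x - a) + (a' - w' x) + (a - a')‖ₑ := by congr 1; ring
    _ ≤ _ := (enorm_add_le _ _).trans (add_le_add_left (enorm_add_le _ _) _)
    _ = _ := by rw [enorm_sub_rev a' (w' x)]

/-- A bounded sequence of functions with uniformly small mean oscillation along suitable finite
coverings has an almost everywhere convergent subsequence. -/
lemma exists_subseq_ae_tendsto_of_oscillation {X : Type*} [MeasurableSpace X] {μ : Measure X}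
    [IsFiniteMeasure μ] {w : ℕ → X → ℝ} (hw : ∀ n, Measurable (w n)) {M : ℝ}
    (hM0 : 0 ≤ M) (hM : ∀ n x, |w n x| ≤ M)
    (hosc : ∀ ε : ℝ≥0∞, ε ≠ 0 → ∃ F : Finset (Set X), (∀ B ∈ F, MeasurableSet B) ∧
      μ (⋃ B ∈ F, B)ᶜ ≤ ε ∧
      ∀ n, ∑ B ∈ F, ∫⁻ y in B, ‖w n y - ⨍ x in B, w n x ∂μ‖ₑ ∂μ ≤ ε) :
    ∃ ψ : ℕ → ℕ, StrictMono ψ ∧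
      ∀ᵐ x ∂μ, ∃ l, Tendsto (fun n => w (ψ n) x) atTop (𝓝 l) := by
  have hpos : ∀ k : ℕ, ((k : ℝ≥0∞) + 1)⁻¹ ≠ 0 := fun k => ENNReal.inv_ne_zero.2 (by simp)
  choose F hFm hFcov hFosc using fun k : ℕ => hosc _ (hpos k)
  have hav : ∀ n (B : Set X), |⨍ x in B, w n x ∂μ| ≤ M := by
    intro n B
    rw [setAverage_eq, smul_eq_mul, abs_mul, abs_of_nonneg (by positivity)]
    have h1 : ‖∫ x in B, w n x ∂μ‖ ≤ M * μ.real B :=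
      norm_setIntegral_le_of_norm_le_const (measure_lt_top μ B) fun x _ => hM n x
    rw [inv_mul_eq_div]
    exact div_le_of_le_mul₀ measureReal_nonneg hM0 h1
  -- All averages, for all coverings at once, form a point of a countable product of intervals; its
  -- sequential compactness replaces a diagonal extraction.
  have hK : IsCompact (univ.pi fun _ : (Σ k : ℕ, F k) => Icc (-M) M) :=
    isCompact_univ_pi fun _ => isCompact_Icc
  obtain ⟨a, -, ψ₁, hψ₁, ha⟩ := hK.isSeqCompact
    (x := fun n (p : Σ k : ℕ, F k) => ⨍ x in (p.2 : Set X), w n x ∂μ)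
    (fun n p _ => abs_le.1 (hav n _))
  have hlim : ∀ (k : ℕ) (B : Set X), B ∈ F k → ∃ b, Tendsto
      (fun n => ⨍ x in B, w (ψ₁ n) x ∂μ) atTop (𝓝 b) := fun k B hB =>
    ⟨_, tendsto_pi_nhds.1 ha ⟨k, ⟨B, hB⟩⟩⟩
  -- Off the covering the integrand is at most `2 * M`; on each block the difference splits into two
  -- oscillations and a difference of averages.
  have hD : ∀ (k n m : ℕ), ∫⁻ x, ‖w n x - w m x‖ₑ ∂μ ≤
      (ENNReal.ofReal (2 * M) + 2) * ((k : ℝ≥0∞) + 1)⁻¹ +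
        ∑ B ∈ F k, ‖(⨍ x in B, w n x ∂μ) - ⨍ x in B, w m x ∂μ‖ₑ * μ B := by
    intro k n m
    have hmU : MeasurableSet (⋃ B ∈ F k, B) := (F k).measurableSet_biUnion (hFm k)
    rw [← lintegral_add_compl _ hmU, add_comm]
    have h1 : ∫⁻ x in (⋃ B ∈ F k, B)ᶜ, ‖w n x - w m x‖ₑ ∂μ ≤
        ENNReal.ofReal (2 * M) * ((k : ℝ≥0∞) + 1)⁻¹ := by
      calc _ ≤ ∫⁻ x in (⋃ B ∈ F k, B)ᶜ, ENNReal.ofReal (2 * M) ∂μ := by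
            refine lintegral_mono fun x => ?_
            rw [Real.enorm_eq_ofReal_abs]
            refine ENNReal.ofReal_le_ofReal ((abs_sub _ _).trans ?_)
            linarith [hM n x, hM m x]
        _ ≤ _ := by
            rw [setLIntegral_const]
            gcongr
            exact hFcov k
    have h2 : ∫⁻ x in ⋃ B ∈ F k, B, ‖w n x - w m x‖ₑ ∂μ ≤
        ((k : ℝ≥0∞) + 1)⁻¹ + ((k : ℝ≥0∞) + 1)⁻¹ +
        ∑ B ∈ F k, ‖(⨍ x in B, w n x ∂μ) - ⨍ x in B, w m x ∂μ‖ₑ * μ B := by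
      calc _ ≤ ∑ B ∈ F k, ∫⁻ x in B, ‖w n x - w m x‖ₑ ∂μ := by
            rw [← Finset.sum_coe_sort, ← tsum_fintype (L := .unconditional _)]
            have hU : ⋃ B ∈ F k, B = ⋃ B : F k, (B : Set X) := by
              ext x
              simp
            rw [hU]
            exact lintegral_iUnion_le _ _
        _ ≤ ∑ B ∈ F k, _ := Finset.sum_le_sum fun B _ =>
            lintegral_enorm_sub_le_of_oscillation (hw n) (hw m)
              (⨍ x in B, w n x ∂μ) (⨍ x in B, w m x ∂μ)
        _ ≤ _ := by
            rw [Finset.sum_add_distrib, Finset.sum_add_distrib]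
            gcongr
            · exact hFosc k n
            · exact hFosc k m
    refine (add_le_add h1 h2).trans_eq ?_
    ring
  have hcauchy : ∀ ε : ℝ≥0∞, ε ≠ 0 → ∃ N, ∀ n ≥ N, ∀ m ≥ N,
      ∫⁻ x, ‖w (ψ₁ n) x - w (ψ₁ m) x‖ₑ ∂μ < ε := by
    intro ε hε
    have hk : Tendsto (fun k : ℕ => (ENNReal.ofReal (2 * M) + 2) * ((k : ℝ≥0∞) + 1)⁻¹) atTop
        (𝓝 0) := by
      have h := ENNReal.Tendsto.const_mul (a := ENNReal.ofReal (2 * M) + 2)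
        ((tendsto_add_atTop_iff_nat 1).2 ENNReal.tendsto_inv_nat_nhds_zero) (Or.inr (by finiteness))
      simpa using h
    have hε2 : (0 : ℝ≥0∞) < ε / 2 := ENNReal.half_pos hε
    obtain ⟨k, hk⟩ := (hk.eventually (gt_mem_nhds hε2)).exists
    have hsum : Tendsto (fun p : ℕ × ℕ => ∑ B ∈ F k,
        ‖(⨍ x in B, w (ψ₁ p.1) x ∂μ) - ⨍ x in B, w (ψ₁ p.2) x ∂μ‖ₑ * μ B) atTop (𝓝 0) := by
      have h0 : (0 : ℝ≥0∞) = ∑ B ∈ F k, 0 := by simp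
      rw [h0]
      refine tendsto_finsetSum _ fun B hB => ?_
      obtain ⟨b, hb⟩ := hlim k B hB
      have h := (hb.comp tendsto_fst).sub (hb.comp tendsto_snd)
      rw [prod_atTop_atTop_eq, sub_self] at h
      have h' := ENNReal.Tendsto.mul_const (b := μ B)
        ((continuous_enorm.tendsto _).comp h) (Or.inr (measure_ne_top μ B))
      simpa [Function.comp_def] using h'
    obtain ⟨⟨N₁, N₂⟩, hN⟩ := eventually_atTop.1 (hsum.eventually (gt_mem_nhds hε2))
    refine ⟨max N₁ N₂, fun n hn m hm => ?_⟩
    refine (hD k _ _).trans_lt ((ENNReal.add_lt_add hk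
      (hN (n, m) ⟨(le_max_left _ _).trans hn, (le_max_right _ _).trans hm⟩)).trans_eq ?_)
    exact ENNReal.add_halves ε
  have hB0 : ∀ N : ℕ, ((2 : ℝ≥0∞)⁻¹) ^ N ≠ 0 := fun N => pow_ne_zero _ (by simp)
  -- Geometric rates are summable, which upgrades `L¹` Cauchy to almost everywhere convergence.
  obtain ⟨ψ₂, hψ₂, hψ₂'⟩ := extraction_forall_of_eventually'
    (P := fun N j => ∀ n ≥ j, ∀ m ≥ j,
      ∫⁻ x, ‖w (ψ₁ n) x - w (ψ₁ m) x‖ₑ ∂μ < ((2 : ℝ≥0∞)⁻¹) ^ N) fun N => by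
    obtain ⟨N', hN'⟩ := hcauchy _ (hB0 N)
    exact ⟨N', fun k hk n hn m hm => hN' n (hk.trans hn) m (hk.trans hm)⟩
  refine ⟨ψ₁ ∘ ψ₂, hψ₁.comp hψ₂, ?_⟩
  refine Lp.ae_tendsto_of_cauchy_eLpNorm (p := 1) (f := fun n => w (ψ₁ (ψ₂ n)))
    (fun n => (hw _).aestronglyMeasurable) le_rfl (B := fun N => ((2 : ℝ≥0∞)⁻¹) ^ N) ?_ ?_
  · rw [ENNReal.tsum_geometric]
    simp
  · intro N n m hn hm
    rw [eLpNorm_one_eq_lintegral_enorm]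
    exact hψ₂' N _ (hψ₂.monotone hn) _ (hψ₂.monotone hm)

/-- Compactness: a sequence with bounded energy `Λ` has, after composition with `arctan`, an
almost everywhere convergent subsequence. -/
lemma exists_subseq_ae_tendsto_arctan {d : ℕ} {φ : ℝ → ℝ}
    (hφ : MonotoneOn φ (Ici 0)) (hpos : ∀ t, 0 < t → 0 < φ t) {Ω : Set (Space d)}
    (hΩ : IsOpen Ω) (hfin : volume Ω ≠ ⊤) {v : ℕ → Space d → ℝ} (hv : ∀ n, Measurable (v n))
    {C : ℝ≥0∞} (hC : C ≠ ⊤) (hΛ : ∀ n, Lambda φ Ω (v n) ≤ C) :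
    ∃ ψ : ℕ → ℕ, StrictMono ψ ∧ ∀ᵐ x ∂volume.restrict Ω, ∃ l,
      Tendsto (fun n => Real.arctan (v (ψ n) x)) atTop (𝓝 l) := by
  have : IsFiniteMeasure (volume.restrict Ω) := ⟨by simpa using hfin.lt_top⟩
  set κ := (volume (Metric.closedBall (0 : Space d) 1))⁻¹
  have hκ : κ ≠ ⊤ := ENNReal.inv_ne_top.2 (Metric.measure_closedBall_pos _ _ one_pos).ne'
  set T := volume Ω + κ * C
  have hT : T ≠ ⊤ := by finiteness
  refine exists_subseq_ae_tendsto_of_oscillation (w := fun n x => Real.arctan (v n x))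
    (fun n => Real.measurable_arctan.comp (hv n)) (by positivity) (fun n x => abs_arctan_le (v n x)) ?_
  intro ε hε
  obtain ⟨t, ht0, ht1, ht2⟩ : ∃ t : ℝ, 0 < t ∧ ENNReal.ofReal t ≤ ε ∧
      ENNReal.ofReal t * T ≤ ε := by
    have h1 : Tendsto (fun t : ℝ => ENNReal.ofReal t) (𝓝[>] 0) (𝓝 0) := by
      simpa using (ENNReal.continuous_ofReal.tendsto 0).mono_left nhdsWithin_le_nhds
    have h2 : Tendsto (fun t : ℝ => ENNReal.ofReal t * T) (𝓝[>] 0) (𝓝 0) := by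
      simpa using ENNReal.Tendsto.mul_const h1 (Or.inr hT)
    have hε' := pos_iff_ne_zero.2 hε
    obtain ⟨t, ht, h⟩ := (eventually_mem_nhdsWithin.and
      ((h1.eventually (ge_mem_nhds hε')).and (h2.eventually (ge_mem_nhds hε')))).exists
    exact ⟨t, ht, h⟩
  obtain ⟨F, hF, hcov, hosc⟩ := exists_covering_sum_oscillation_le hφ hpos hΩ hfin ht0
  have hres : ∀ B ∈ F, (volume.restrict Ω).restrict B = (volume : Measure (Space d)).restrict B :=
    fun B hB => Measure.restrict_restrict_of_subset (hF B hB).2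
  refine ⟨F, fun B hB => (hF B hB).1, ?_, fun n => ?_⟩
  · rw [Measure.restrict_apply' hΩ.measurableSet, inter_comm, ← sdiff_eq]
    exact hcov.trans ht1
  · rw [Finset.sum_congr rfl fun B hB => by rw [hres B hB]]
    refine (hosc (v n) (hv n)).trans (le_trans ?_ ht2)
    exact mul_le_mul_right (add_le_add_right (mul_le_mul_right (hΛ n) _) _) _

/-! ### Semicontinuity and compactness for the energy. -/

lemma liminf_add_liminf_le (a b : ℕ → ℝ≥0∞) :
    liminf a atTop + liminf b atTop ≤ liminf (fun n => a n + b n) atTop := by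
  simp only [liminf_eq_iSup_iInf_of_nat]
  rw [ENNReal.iSup_add_iSup_of_monotone]
  · exact iSup_mono fun n => le_iInf₂ fun i hi =>
      add_le_add (iInf₂_le i hi) (iInf₂_le i hi)
  · exact fun m n hmn => le_iInf₂ fun i hi => iInf₂_le i (hmn.trans hi)
  · exact fun m n hmn => le_iInf₂ fun i hi => iInf₂_le i (hmn.trans hi)

lemma exists_frequently_abs_le_of_liminf_ne_top {a : ℕ → ℝ} {c q : ℝ} (hq : 1 ≤ q)
    (h : liminf (fun n => ENNReal.ofReal (|a n - c| ^ q)) atTop ≠ ⊤) :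
    ∃ K, ∃ᶠ n in atTop, |a n| ≤ K := by
  obtain ⟨K, hK, -⟩ := ENNReal.lt_iff_exists_nnreal_btwn.1 h.lt_top
  -- The `1` covers `|a n - c| ≤ 1`; beyond it, `q ≥ 1` gives `|a n - c| ≤ |a n - c| ^ q`.
  refine ⟨max 1 K + |c|, (frequently_lt_of_liminf_lt (by isBoundedDefault) hK).mono
    fun n hn => ?_⟩
  have h1 : |a n - c| ^ q ≤ K := by
    have := ENNReal.toReal_mono ENNReal.coe_ne_top hn.le
    rwa [ENNReal.toReal_ofReal (by positivity), ENNReal.coe_toReal] at this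
  have h2 : |a n - c| ≤ max 1 K := by
    rcases le_total |a n - c| 1 with h | h
    · exact h.trans (le_max_left _ _)
    · exact (Real.self_le_rpow_of_one_le h hq).trans (h1.trans (le_max_right _ _))
  have h3 := abs_add_le (a n - c) c
  rw [sub_add_cancel] at h3
  linarith

lemma memLp_of_lintegral_rpow_abs_ne_top {X : Type*} [MeasurableSpace X] {μ : Measure X} {q : ℝ}
    (hq : 1 ≤ q) {h : X → ℝ} (hm : AEStronglyMeasurable h μ)
    (hfin : ∫⁻ x, ENNReal.ofReal (|h x| ^ q) ∂μ ≠ ⊤) : MemLp h (ENNReal.ofReal q) μ := by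
  have hq0 : 0 < q := one_pos.trans_le hq
  refine ⟨hm, (eLpNorm_lt_top_iff_lintegral_rpow_enorm_lt_top (ENNReal.ofReal_pos.2 hq0).ne'
    ENNReal.ofReal_ne_top).2 ?_⟩
  rw [ENNReal.toReal_ofReal hq0.le]
  refine (lintegral_congr fun x => ?_).trans_lt hfin.lt_top
  rw [Real.enorm_eq_ofReal_abs, ENNReal.ofReal_rpow_of_nonneg (abs_nonneg _) hq0.le]

lemma measurable_LqSpace {d : ℕ} {q : ℝ} {Ω : Set (Space d)} (u : LqSpace q Ω) : Measurable u :=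
  (Lp.stronglyMeasurable u).measurable

/-- Lower semicontinuity of the energy under almost everywhere convergence. -/
lemma ClassA.energy_le_liminf {d : ℕ} {φ : ℝ → ℝ} (hφ : ClassA d φ) {Ω : Set (Space d)}
    {q lam δ : ℝ} (hq : 1 ≤ q) {f : LqSpace q Ω} {u : ℕ → LqSpace q Ω}
    {w : LqSpace q Ω}
    (h : ∀ᵐ x ∂volume.restrict Ω, Tendsto (fun n => u n x) atTop (𝓝 (w x))) :
    energy φ Ω q lam δ f w ≤ liminf (fun n => energy φ Ω q lam δ f (u n)) atTop := by
  have h1 : ∫⁻ x in Ω, ENNReal.ofReal (|w x - f x| ^ q) ≤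
      liminf (fun n => ∫⁻ x in Ω, ENNReal.ofReal (|u n x - f x| ^ q)) atTop := by
    refine le_trans (lintegral_mono_ae ?_) (lintegral_liminf_le fun n => ?_)
    · filter_upwards [h] with x hx
      refine (Tendsto.liminf_eq ?_).ge
      exact ENNReal.tendsto_ofReal (((hx.sub_const _).abs).rpow_const (Or.inr (by linarith)))
    · exact (((measurable_LqSpace (u n)).sub (measurable_LqSpace f)).abs.pow_const q).ennreal_ofReal
  have h2 : Lambda φ Ω (fun x => w x / δ) ≤
      liminf (fun n => Lambda φ Ω fun x => u n x / δ) atTop :=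
    hφ.Lambda_le_liminf (fun n => (measurable_LqSpace (u n)).div_const δ)
      (h.mono fun x hx => hx.div_const δ)
  refine le_trans ?_ (liminf_add_liminf_le _ _)
  unfold LambdaDelta
  rw [ENNReal.liminf_const_mul_of_ne_top ENNReal.ofReal_ne_top,
    ENNReal.liminf_const_mul_of_ne_top ENNReal.ofReal_ne_top]
  exact add_le_add (mul_le_mul_right h1 _) (mul_le_mul_right h2 _)

/-- Sequences of bounded energy are precompact for almost everywhere convergence. -/
lemma ClassA.exists_subseq_ae_tendsto_of_energy_le {d : ℕ} {φ : ℝ → ℝ} (hφ : ClassA d φ)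
    (hpos : ∀ t, 0 < t → 0 < φ t) {Ω : Set (Space d)} (hΩ : IsOpen Ω) (hfin : volume Ω ≠ ⊤)
    {q lam δ : ℝ} (hq : 1 ≤ q) (hlam : 0 < lam) (hδ : 0 < δ) {f : LqSpace q Ω}
    {u : ℕ → LqSpace q Ω} {C : ℝ≥0∞} (hC : C ≠ ⊤) (hu : ∀ n, energy φ Ω q lam δ f (u n) ≤ C) :
    ∃ (ψ : ℕ → ℕ) (w : LqSpace q Ω), StrictMono ψ ∧
      ∀ᵐ x ∂volume.restrict Ω, Tendsto (fun n => u (ψ n) x) atTop (𝓝 (w x)) := by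
  have hΛ : ∀ n, Lambda φ Ω (fun x => u n x / δ) ≤ C / ENNReal.ofReal δ := fun n => by
    rw [ENNReal.le_div_iff_mul_le (Or.inl (ENNReal.ofReal_pos.2 hδ).ne')
      (Or.inl ENNReal.ofReal_ne_top), mul_comm]
    exact (le_add_left le_rfl).trans (hu n)
  have hL : ∀ n, ∫⁻ x in Ω, ENNReal.ofReal (|u n x - f x| ^ q) ≤ C / ENNReal.ofReal lam :=
    fun n => by
    rw [ENNReal.le_div_iff_mul_le (Or.inl (ENNReal.ofReal_pos.2 hlam).ne')
      (Or.inl ENNReal.ofReal_ne_top), mul_comm]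
    exact (le_add_right le_rfl).trans (hu n)
  obtain ⟨ψ, hψ, hlim⟩ := exists_subseq_ae_tendsto_arctan hφ.monotone hpos hΩ hfin
    (fun n => (measurable_LqSpace (u n)).div_const δ)
    (ENNReal.div_ne_top hC (ENNReal.ofReal_pos.2 hδ).ne') hΛ
  have hmeas : ∀ n, Measurable fun x => ENNReal.ofReal (|u n x - f x| ^ q) := fun n =>
    (((measurable_LqSpace (u n)).sub (measurable_LqSpace f)).abs.pow_const q).ennreal_ofReal
  -- By Fatou this liminf is finite almost everywhere, so at almost every point some subsequence
  -- stays bounded, which is enough to remove `arctan`.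
  have hint : ∫⁻ x in Ω, liminf (fun n => ENNReal.ofReal (|u (ψ n) x - f x| ^ q)) atTop ≠ ⊤ := by
    refine ne_top_of_le_ne_top (ENNReal.div_ne_top hC (ENNReal.ofReal_pos.2 hlam).ne')
      ((lintegral_liminf_le fun n => hmeas (ψ n)).trans ?_)
    exact liminf_le_of_frequently_le' (Frequently.of_forall fun n => hL (ψ n))
  have hconv : ∀ᵐ x ∂volume.restrict Ω, ∃ l, Tendsto (fun n => u (ψ n) x) atTop (𝓝 l) := by
    filter_upwards [hlim, ae_lt_top (Measurable.liminf fun n => hmeas (ψ n)) hint]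
      with x ⟨l, hl⟩ hx
    obtain ⟨K, hK⟩ := exists_frequently_abs_le_of_liminf_ne_top hq hx.ne
    obtain ⟨b, hb⟩ := exists_tendsto_of_tendsto_arctan (K := K / δ) hl (hK.mono fun n hn => by
      rw [abs_div, abs_of_pos hδ]
      gcongr)
    refine ⟨b * δ, (hb.mul_const δ).congr fun n => ?_⟩
    field_simp
  obtain ⟨g, hg, hgt⟩ := measurable_limit_of_tendsto_metrizable_ae
    (fun n => (measurable_LqSpace (u (ψ n))).aemeasurable) hconv
  -- The same Fatou bound puts `g - f`, hence `g`, in `L^q`.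
  have hgf : MemLp (fun x => g x - f x) (ENNReal.ofReal q) (volume.restrict Ω) := by
    refine memLp_of_lintegral_rpow_abs_ne_top hq
      (hg.sub (measurable_LqSpace f)).aestronglyMeasurable (ne_top_of_le_ne_top hint ?_)
    refine lintegral_mono_ae ?_
    filter_upwards [hgt] with x hx
    refine (Tendsto.liminf_eq ?_).ge
    exact ENNReal.tendsto_ofReal (((hx.sub_const _).abs).rpow_const (Or.inr (by linarith)))
  have hgL : MemLp g (ENNReal.ofReal q) (volume.restrict Ω) :=
    (hgf.add (Lp.memLp f)).congr_norm hg.aestronglyMeasurable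
      (Eventually.of_forall fun x => by simp)
  refine ⟨ψ, hgL.toLp g, hψ, ?_⟩
  filter_upwards [hgt, hgL.coeFn_toLp] with x hx hx'
  rwa [hx']

end NonlocalTV

/-! ### The direct method. -/

theorem mainTheorem5 (d : ℕ) (hd : 1 ≤ d)
    (Ω : Set (NonlocalTV.Space d)) (hΩ : NonlocalTV.IsSmoothBoundedOpen Ω)
    (q : ℝ) (hq : 1 ≤ q) (lam : ℝ) (hlam : 0 < lam) (δ : ℝ) (hδ : 0 < δ)
    (f : NonlocalTV.LqSpace q Ω)
    (φ : ℝ → ℝ) (hφ : NonlocalTV.ClassA d φ) (hφpos : ∀ t, 0 < t → 0 < φ t) :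
    ∃ u : NonlocalTV.LqSpace q Ω,
      NonlocalTV.energy φ Ω q lam δ f u =
        ⨅ w : NonlocalTV.LqSpace q Ω, NonlocalTV.energy φ Ω q lam δ f w := by
  set I := ⨅ w : NonlocalTV.LqSpace q Ω, NonlocalTV.energy φ Ω q lam δ f w with hI
  have hIle : ∀ w, I ≤ NonlocalTV.energy φ Ω q lam δ f w := iInf_le _
  -- If no function has finite energy, every function is a minimizer.
  by_cases htop : I = ⊤
  · exact ⟨0, le_antisymm (htop ▸ le_top) (hIle 0)⟩
  have hseq : ∀ n : ℕ, ∃ w, NonlocalTV.energy φ Ω q lam δ f w < I + ((n : ℝ≥0∞) + 1)⁻¹ := fun n =>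
    iInf_lt_iff.1 (ENNReal.lt_add_right htop (ENNReal.inv_ne_zero.2 (by simp)))
  choose u hu using hseq
  have hC : ∀ n, NonlocalTV.energy φ Ω q lam δ f (u n) ≤ I + 1 := fun n =>
    (hu n).le.trans (add_le_add_right (ENNReal.inv_le_one.2 (by simp)) _)
  obtain ⟨ψ, w, hψ, hw⟩ := hφ.exists_subseq_ae_tendsto_of_energy_le hφpos hΩ.isOpen
    hΩ.isBounded.measure_lt_top.ne hq hlam hδ (by finiteness) hC
  refine ⟨w, le_antisymm ((hφ.energy_le_liminf hq hw).trans ?_) (hIle w)⟩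
  have hlim : Tendsto (fun n => I + ((ψ n : ℝ≥0∞) + 1)⁻¹) atTop (𝓝 I) := by
    have h0 : Tendsto (fun n : ℕ => ((n : ℝ≥0∞) + 1)⁻¹) atTop (𝓝 0) := by
      simpa using (tendsto_add_atTop_iff_nat 1).2 ENNReal.tendsto_inv_nat_nhds_zero
    simpa using tendsto_const_nhds.add (h0.comp hψ.tendsto_atTop)
  rw [← hlim.liminf_eq]
  exact liminf_le_liminf (Eventually.of_forall fun n => (hu (ψ n)).le)
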